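/- All graphs are finite and simple. For integers $1\le a\le b$ with $a\equiv b\pmod 2$, an $(a,b)$-parity factor of a graph $G$ is a spanning subgraph $F$ of $G$ such that $a\le d_F(v)\le b$ and $d_F(v)\equiv b\pmod 2$ for every vertex $v$ of $G$. A graph is $m$-edge-connected if it remains connected after the deletion of any set of fewer than $m$ edges. **Theorem 2.1.** Let $a,b,r$ be integers with $1\le a\le b<r$ and $a\equiv b\pmod 2$, let $m\ge 1$ be an integer, and let $m^*$ be the odd element of $\{m,m+1\}$. Let $G$ be an $m$-edge-connected $r$-regular graph, and let $|G|$ denote its number of vertices. If one of the following conditions holds, then $G$ has an $(a,b)$-parity factor: (i) $r$ is even, $a$ and $b$ are odd, $|G|$ is even, $\dfrac{r}{m}\le b$ and $a\le r\left(1-\dfrac1m\right)$; (ii) $r$ is odd, $a$ and $b$ are even, and $a\le r\left(1-\dfrac1{m^*}\right)$; (iii) $r$, $a$ and $b$ are all odd, and $\dfrac{r}{m^*}\le b$. -/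

import Mathlib

namespace SimpleGraph

open Classical in
/-- A spanning subgraph `F` of a finite simple graph `G` (that is, a graph on the same vertex set
with `F ≤ G`) is a `(g, f)`-parity factor of `G` if every vertex `v` satisfies
`g v ≤ d_F(v) ≤ f v` and `d_F(v) ≡ f v (mod 2)`. -/
def IsParityFactor {V : Type*} [Fintype V] (G F : SimpleGraph V) (g f : V → ℕ) : Prop :=
  F ≤ G ∧ ∀ v : V, g v ≤ F.degree v ∧ F.degree v ≤ f v ∧ F.degree v ≡ f v [MOD 2]

/-- `G` has an `(a, b)`-parity factor: a `(g, f)`-parity factor for the constant functions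
`g = a` and `f = b`. -/
def HasParityFactor {V : Type*} [Fintype V] (G : SimpleGraph V) (a b : ℕ) : Prop :=
  ∃ F : SimpleGraph V, G.IsParityFactor F (fun _ => a) (fun _ => b)

end SimpleGraph

section

open Finset

/-! Parity factors become perfect matchings of a gadget. Each vertex `v` is replaced by its `r`
outgoing darts, completely joined to `r - b` independent vertices (`B`) and a clique on `b - a`
vertices (`C`); each dart is joined to its reversal. The edges whose two darts are matched together
form the factor: at `v` their number is `a` plus the even number of vertices of `C` matched inside
the clique.

If there is no perfect matching, Tutte's theorem gives a set `X` with more than `#X` odd pieces.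
When `#X` is minimal, each element of `X` meets at least three pieces, so `X` consists of all darts
leaving a set `S` and all non-dart vertices over a disjoint set `T`. A total charge of `r * #X` is
then spread over the gadget. A piece is either charged `r` by a single vertex, or comes from a
vertex set `U` outside `S` and `T`, with `s` edges to `S` and `t` to `T`, and has charge at least `b
* s + (r - a) * t`. If each such value is at least `r`, there are at most `#X` pieces, a
contradiction.

Edge-connectivity gives `s + t ≥ m`, and oddness of the piece makes `a * #U + t` odd; the three
numerical conditions turn this into the required bound. -/

/-- A finset with a fixed-point-free involution has even cardinality. -/
theorem Finset.even_card_of_involution {α : Type*} (s : Finset α) (f : α → α)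
    (hmem : ∀ x ∈ s, f x ∈ s) (hinv : ∀ x ∈ s, f (f x) = x) (hne : ∀ x ∈ s, f x ≠ x) :
    Even #s := by
  have h : ∑ _x ∈ s, (1 : ZMod 2) = 0 :=
    Finset.sum_involution (fun x _ => f x) (fun _ _ => by decide) (fun x hx _ => hne x hx)
      (fun x hx => hmem x hx) (fun x hx => hinv x hx)
  rw [Finset.sum_const, nsmul_one] at h
  exact (ZMod.natCast_eq_zero_iff_even).1 h

end

namespace SimpleGraph

open Finset

/-! ### Tutte violators and their minimal form -/

section

/-- A family of pairwise disjoint sets of odd size avoiding `X`, each of which is a union of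
components of `H - X`. -/
structure IsOddFamily {W : Type*} (H : SimpleGraph W) (X : Finset W) (𝒦 : Finset (Finset W)) :
    Prop where
  eq_of_mem : ∀ K ∈ 𝒦, ∀ L ∈ 𝒦, ∀ y ∈ K, y ∈ L → K = L
  odd_card : ∀ K ∈ 𝒦, Odd #K
  notMem : ∀ K ∈ 𝒦, ∀ y ∈ K, y ∉ X
  mem_of_adj : ∀ K ∈ 𝒦, ∀ y ∈ K, ∀ z, H.Adj y z → z ∉ X → z ∈ K

variable {W : Type*} {H : SimpleGraph W} {X : Finset W} {𝒦 : Finset (Finset W)}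

theorem IsOddFamily.subset (h : H.IsOddFamily X 𝒦) {𝒦' : Finset (Finset W)} (hs : 𝒦' ⊆ 𝒦) :
    H.IsOddFamily X 𝒦' :=
  ⟨fun K hK L hL => h.eq_of_mem K (hs hK) L (hs hL), fun K hK => h.odd_card K (hs hK),
    fun K hK => h.notMem K (hs hK), fun K hK => h.mem_of_adj K (hs hK)⟩

theorem IsOddFamily.pairwiseDisjoint (h : H.IsOddFamily X 𝒦) :
    (𝒦 : Set (Finset W)).PairwiseDisjoint id := by
  intro K hK L hL hne
  exact Finset.disjoint_left.2 fun y hy hy' => hne (h.eq_of_mem K hK L hL y hy hy')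

variable [Fintype W]

/-- The nontrivial direction of Tutte's theorem in terms of odd families. -/
theorem exists_isOddFamily_of_forall_not_isPerfectMatching
    (h : ∀ M : H.Subgraph, ¬ M.IsPerfectMatching) :
    ∃ (X : Finset W) (𝒦 : Finset (Finset W)), H.IsOddFamily X 𝒦 ∧ #X < #𝒦 := by
  classical
  have h' : ¬ ∀ u, ¬ H.IsTutteViolator u := fun hu => by
    obtain ⟨M, hM⟩ := tutte.2 hu
    exact h M hM
  push Not at h'
  obtain ⟨u, hu⟩ := h'
  unfold IsTutteViolator at hu
  set H' := ((⊤ : H.Subgraph).deleteVerts u).coe with hH'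
  have hverts : ∀ y, y ∈ ((⊤ : H.Subgraph).deleteVerts u).verts ↔ y ∉ u := by simp
  let φ : H'.ConnectedComponent → Finset W := fun c => (Subtype.val '' c.supp).toFinset
  have hφ : ∀ c y, y ∈ φ c ↔ ∃ hy : y ∉ u, H'.connectedComponentMk ⟨y, (hverts y).2 hy⟩ = c := by
    intro c y
    simp [φ]
  have hcard : ∀ c, #(φ c) = c.supp.ncard := by
    intro c
    rw [← Set.ncard_eq_toFinset_card', Set.ncard_image_of_injective _ Subtype.val_injective]
  have hinj : Function.Injective φ := by
    intro c d hcd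
    induction c using ConnectedComponent.ind with
    | h y =>
      have hy : y.1 ∈ φ (H'.connectedComponentMk y) := (hφ _ _).2 ⟨(hverts _).1 y.2, rfl⟩
      rw [hcd, hφ] at hy
      exact hy.2
  refine ⟨u.toFinset, H'.oddComponents.toFinset.image φ, ⟨?_, ?_, ?_, ?_⟩, ?_⟩
  · simp only [mem_image, forall_exists_index, and_imp]
    rintro _ c - rfl _ d - rfl y hy hy'
    obtain ⟨_, rfl⟩ := (hφ _ _).1 hy
    obtain ⟨_, rfl⟩ := (hφ _ _).1 hy'
    rfl
  · simp only [mem_image, forall_exists_index, and_imp, Set.mem_toFinset]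
    rintro _ c hc rfl
    rw [hcard]
    exact hc
  · simp only [mem_image, forall_exists_index, and_imp, Set.mem_toFinset]
    rintro _ c - rfl y hy
    exact ((hφ _ _).1 hy).1
  · simp only [mem_image, forall_exists_index, and_imp, Set.mem_toFinset]
    rintro _ c - rfl y hy z hyz hz
    obtain ⟨hyu, rfl⟩ := (hφ _ _).1 hy
    refine (hφ _ _).2 ⟨hz, ConnectedComponent.sound (Adj.reachable ?_)⟩
    simp [hH', hyz.symm, hz, hyu]
  · rw [card_image_of_injective _ hinj, ← Set.ncard_eq_toFinset_card',
      ← Set.ncard_eq_toFinset_card']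
    exact hu

/-- In a graph of even order, the surplus of an odd family can be taken to be even. -/
theorem IsOddFamily.exists_add_two_le (hW : Even (Fintype.card W)) (h : H.IsOddFamily X 𝒦)
    (hlt : #X < #𝒦) : ∃ 𝒦', H.IsOddFamily X 𝒦' ∧ #X + 2 ≤ #𝒦' := by
  classical
  by_cases h2 : #X + 2 ≤ #𝒦
  · exact ⟨𝒦, h, h2⟩
  set L := (X ∪ 𝒦.biUnion id)ᶜ with hL
  have hmemL : ∀ y, y ∈ L ↔ y ∉ X ∧ ∀ K ∈ 𝒦, y ∉ K := by
    intro y; simp [hL]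
  have hdisj : Disjoint X (𝒦.biUnion id) := by
    refine Finset.disjoint_left.2 fun y hy hy' => ?_
    obtain ⟨K, hK, hyK⟩ := mem_biUnion.1 hy'
    exact h.notMem K hK y hyK hy
  -- With `#𝒦 = #X + 1`, the set `X` and the members together cover an odd number of vertices, so
  -- the rest is odd and can serve as one more member.
  have hodd : Odd #L := by
    have h1 : #L + (#X + ∑ K ∈ 𝒦, #K) = Fintype.card W := by
      rw [← card_compl_add_card (X ∪ 𝒦.biUnion id), card_union_of_disjoint hdisj,
        card_biUnion h.pairwiseDisjoint]
      simp [hL]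
    have h3 : Even (∑ K ∈ 𝒦, #K) ↔ Even #𝒦 := by
      have : (∑ K ∈ 𝒦, (#K : ZMod 2)) = #𝒦 := by
        rw [Finset.sum_congr rfl fun K hK => (ZMod.natCast_eq_one_iff_odd).2 (h.odd_card K hK)]
        simp
      rw [← ZMod.natCast_eq_zero_iff_even, ← ZMod.natCast_eq_zero_iff_even (n := #𝒦), ← this]
      push_cast
      rfl
    have h4 : #𝒦 = #X + 1 := by omega
    rw [← h1] at hW
    grind
  have hne : L ∉ 𝒦 := by
    intro hm
    obtain ⟨y, hy⟩ := card_pos.1 hodd.pos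
    exact ((hmemL y).1 hy).2 L hm hy
  refine ⟨insert L 𝒦, ⟨?_, ?_, ?_, ?_⟩, ?_⟩
  · intro K hK K' hK' y hy hy'
    rcases mem_insert.1 hK with rfl | hK <;> rcases mem_insert.1 hK' with rfl | hK'
    · rfl
    · exact absurd hy' (((hmemL y).1 hy).2 _ hK')
    · exact absurd hy (((hmemL y).1 hy').2 _ hK)
    · exact h.eq_of_mem K hK K' hK' y hy hy'
  · intro K hK
    rcases mem_insert.1 hK with rfl | hK
    exacts [hodd, h.odd_card K hK]
  · intro K hK y hy
    rcases mem_insert.1 hK with rfl | hK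
    exacts [((hmemL y).1 hy).1, h.notMem K hK y hy]
  · intro K hK y hy z hyz hz
    rcases mem_insert.1 hK with rfl | hK
    · refine (hmemL z).2 ⟨hz, fun K hK hzK => ?_⟩
      exact ((hmemL y).1 hy).2 K hK (h.mem_of_adj K hK z hzK y hyz.symm ((hmemL y).1 hy).1)
    · exact h.mem_of_adj K hK y hy z hyz hz
  · rw [card_insert_of_notMem hne]
    omega

/-- A graph of even order without perfect matchings has a Tutte violator each of whose elements
is adjacent to at least three members of the odd family. -/
theorem exists_isOddFamily_minimal (hW : Even (Fintype.card W))
    (h : ∀ M : H.Subgraph, ¬ M.IsPerfectMatching) :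
    ∃ (X : Finset W) (𝒦 : Finset (Finset W)), H.IsOddFamily X 𝒦 ∧ #X < #𝒦 ∧
      ∀ x ∈ X, ∀ y₁ y₂, ∃ K ∈ 𝒦, y₁ ∉ K ∧ y₂ ∉ K ∧ ∃ y ∈ K, H.Adj x y := by
  classical
  have hex : ∃ n, ∃ (X : Finset W) (𝒦 : Finset (Finset W)),
      H.IsOddFamily X 𝒦 ∧ #X < #𝒦 ∧ #X = n := by
    obtain ⟨X, 𝒦, h1, h2⟩ := exists_isOddFamily_of_forall_not_isPerfectMatching h
    exact ⟨_, X, 𝒦, h1, h2, rfl⟩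
  obtain ⟨X, 𝒦₀, hX₀, hlt₀, hn⟩ := Nat.find_spec hex
  obtain ⟨𝒦, hX, hlt⟩ := hX₀.exists_add_two_le hW hlt₀
  refine ⟨X, 𝒦, hX, by omega, fun x hx y₁ y₂ => ?_⟩
  by_contra! hcon
  have hcard1 : ∀ y, #{K ∈ 𝒦 | y ∈ K} ≤ 1 := by
    intro y
    refine card_le_one.2 fun K hK L hL => ?_
    rw [mem_filter] at hK hL
    exact hX.eq_of_mem K hK.1 L hL.1 y hK.2 hL.2
  set 𝒦' := {K ∈ 𝒦 | y₁ ∉ K ∧ y₂ ∉ K} with h𝒦'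
  have hle : #𝒦 ≤ #𝒦' + 2 := by
    have hsub : 𝒦 ⊆ 𝒦' ∪ ({K ∈ 𝒦 | y₁ ∈ K} ∪ {K ∈ 𝒦 | y₂ ∈ K}) := by
      intro K hK
      simp only [h𝒦', mem_union, mem_filter, hK, true_and]
      tauto
    have h1 := card_le_card hsub
    have h2 := card_union_le 𝒦' ({K ∈ 𝒦 | y₁ ∈ K} ∪ {K ∈ 𝒦 | y₂ ∈ K})
    have h3 := card_union_le {K ∈ 𝒦 | y₁ ∈ K} {K ∈ 𝒦 | y₂ ∈ K}
    have := hcard1 y₁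
    have := hcard1 y₂
    omega
  have hpos : 0 < #X := card_pos.2 ⟨x, hx⟩
  -- Moving `x` out of `X` spoils only the at most two members containing `y₁` or `y₂`. The surplus
  -- of two pays for dropping them, giving a smaller violator.
  refine Nat.find_min hex (m := #X - 1) (by omega)
    ⟨X.erase x, 𝒦', ⟨?_, ?_, ?_, ?_⟩, ?_, card_erase_of_mem hx⟩
  · exact (hX.subset (filter_subset _ _)).eq_of_mem
  · exact (hX.subset (filter_subset _ _)).odd_card
  · intro K hK y hy hyX
    exact hX.notMem K (mem_filter.1 hK).1 y hy (mem_of_mem_erase hyX)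
  · intro K hK y hy z hyz hz
    obtain ⟨hK, hK1, hK2⟩ := mem_filter.1 hK
    by_cases hzx : z = x
    · subst hzx
      exact absurd hyz.symm (hcon K hK hK1 hK2 y hy)
    · exact hX.mem_of_adj K hK y hy z hyz fun hzX => hz (mem_erase.2 ⟨hzx, hzX⟩)
  · rw [card_erase_of_mem hx]
    omega

end

/-! ### The gadget and its perfect matchings -/

section

variable {V : Type*} {G : SimpleGraph V} {B C : Type*}

/-- Tutte's gadget for parity factors: every vertex `v` of `G` is replaced by the complete
bipartite graph between the darts leaving `v` and a copy of `B ⊕ C`, the copies of `C` are turned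
into cliques, and every dart is joined to its reversal. -/
def parityGadget (G : SimpleGraph V) (B C : Type*) : SimpleGraph (G.Dart ⊕ V × (B ⊕ C)) where
  Adj
    | .inl d, .inl e => e = d.symm
    | .inl d, .inr p => d.fst = p.1
    | .inr p, .inl d => d.fst = p.1
    | .inr (v, .inr i), .inr (w, .inr j) => v = w ∧ i ≠ j
    | _, _ => False
  symm := by
    constructor
    rintro (d | ⟨v, i | i⟩) (e | ⟨w, j | j⟩) h <;> simp_all [eq_comm]
  loopless := by
    constructor
    rintro (d | ⟨v, i | i⟩) h
    · exact d.symm_ne h.symm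
    · exact h
    · exact h.2 rfl

@[simp] theorem parityGadget_adj_inl_inl {d e : G.Dart} :
    (G.parityGadget B C).Adj (.inl d) (.inl e) ↔ e = d.symm := Iff.rfl

@[simp] theorem parityGadget_adj_inl_inr {d : G.Dart} {v : V} {z : B ⊕ C} :
    (G.parityGadget B C).Adj (.inl d) (.inr (v, z)) ↔ d.fst = v := Iff.rfl

@[simp] theorem parityGadget_adj_inr_inl {d : G.Dart} {v : V} {z : B ⊕ C} :
    (G.parityGadget B C).Adj (.inr (v, z)) (.inl d) ↔ d.fst = v := by
  cases z <;> rfl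

@[simp] theorem parityGadget_adj_inr_inr {v w : V} {z z' : B ⊕ C} :
    (G.parityGadget B C).Adj (.inr (v, z)) (.inr (w, z')) ↔
      v = w ∧ z ≠ z' ∧ z.isRight ∧ z'.isRight := by
  cases z <;> cases z' <;> simp [parityGadget]

/-- A perfect matching of the gadget yields a parity factor. -/
theorem hasParityFactor_of_isPerfectMatching [Fintype V] [DecidableRel G.Adj] [Fintype B]
    [Fintype C] {a b r : ℕ} (hreg : G.IsRegularOfDegree r) (hab : a ≤ b) (hbr : b ≤ r)
    (hpar : a ≡ b [MOD 2]) (hB : Fintype.card B = r - b) (hC : Fintype.card C = b - a)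
    {M : (G.parityGadget B C).Subgraph} (hM : M.IsPerfectMatching) : G.HasParityFactor a b := by
  classical
  rw [Subgraph.isPerfectMatching_iff] at hM
  choose p hp hp' using hM
  have hpM : ∀ x y, M.Adj x y ↔ p x = y :=
    fun x y => ⟨fun h => (hp' x y h).symm, fun h => h ▸ hp x⟩
  have hpp : ∀ x, p (p x) = x := fun x => (hpM _ _).1 (hp x).symm
  have hinj : Function.Injective p := Function.LeftInverse.injective hpp
  have hadj : ∀ x, (G.parityGadget B C).Adj x (p x) := fun x => (hp x).adj_sub
  let F : SimpleGraph V :=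
    { Adj := fun u v => ∃ h : G.Adj u v, p (.inl ⟨(u, v), h⟩) = .inl ⟨(v, u), h.symm⟩
      symm := by
        constructor
        rintro u v ⟨h, hp⟩
        exact ⟨h.symm, by rw [← hp, hpp]⟩
      loopless := ⟨fun u ⟨h, _⟩ => h.ne rfl⟩ }
  refine ⟨F, fun u v h => h.1, fun v => ?_⟩
  set D₁ : Finset G.Dart := {d | d.fst = v ∧ p (.inl d) = .inl d.symm} with hD₁
  set D₂ : Finset G.Dart := {d | d.fst = v ∧ ∃ z, p (.inl d) = .inr (v, z)} with hD₂
  set Z₁ : Finset (B ⊕ C) := {z | ∃ d, p (.inr (v, z)) = .inl d} with hZ₁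
  set Z₂ : Finset (B ⊕ C) := {z | ∃ z', p (.inr (v, z)) = .inr (v, z')} with hZ₂
  have hdeg : F.degree v = #D₁ := by
    rw [← card_neighborFinset_eq_degree]
    symm
    refine card_bij (fun d _ => d.snd) ?_ ?_ ?_
    · rintro ⟨⟨x, y⟩, h⟩ hd
      simp only [hD₁, mem_filter, mem_univ, true_and] at hd
      obtain ⟨rfl, hd⟩ := hd
      rw [mem_neighborFinset]
      exact ⟨h, hd⟩
    · rintro ⟨⟨x, y⟩, h⟩ hd ⟨⟨x', y'⟩, h'⟩ hd' hy
      simp only [hD₁, mem_filter, mem_univ, true_and] at hd hd'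
      obtain ⟨rfl, -⟩ := hd
      obtain ⟨rfl, -⟩ := hd'
      simp only at hy
      subst hy
      rfl
    · intro y hy
      rw [mem_neighborFinset] at hy
      obtain ⟨h, hy⟩ := hy
      exact ⟨⟨(v, y), h⟩, by simpa [hD₁] using hy, rfl⟩
  have hD : #D₁ + #D₂ = r := by
    rw [← hreg v, ← G.dart_fst_fiber_card_eq_degree v, ← card_union_of_disjoint]
    · congr 1
      ext d
      simp only [hD₁, hD₂, mem_union, mem_filter, mem_univ, true_and, ← and_or_left,
        and_iff_left_iff_imp]
      rintro rfl
      have := hadj (.inl d)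
      rcases hd : p (.inl d) with e | ⟨w, z⟩
      · rw [hd] at this
        left
        rw [parityGadget_adj_inl_inl.1 this]
      · rw [hd] at this
        right
        exact ⟨z, by rw [parityGadget_adj_inl_inr.1 this]⟩
    · refine Finset.disjoint_left.2 fun d hd hd' => ?_
      obtain ⟨-, -, h1⟩ := mem_filter.1 hd
      obtain ⟨-, -, z, h2⟩ := mem_filter.1 hd'
      simp [h1] at h2
  have hZ : #Z₁ + #Z₂ = r - a := by
    have : Fintype.card (B ⊕ C) = r - a := by
      rw [Fintype.card_sum, hB, hC]; omega
    rw [← this, ← card_union_of_disjoint]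
    · rw [← card_univ]
      congr 1
      ext z
      simp only [hZ₁, hZ₂, mem_union, mem_filter, mem_univ, true_and, iff_true]
      have := hadj (.inr (v, z))
      rcases hd : p (.inr (v, z)) with e | ⟨w, z'⟩
      · exact .inl ⟨e, rfl⟩
      · rw [hd, parityGadget_adj_inr_inr] at this
        exact .inr ⟨z', by rw [this.1]⟩
    · refine Finset.disjoint_left.2 fun d hd hd' => ?_
      obtain ⟨-, d, h1⟩ := mem_filter.1 hd
      obtain ⟨-, z, h2⟩ := mem_filter.1 hd'
      simp [h1] at h2
  have hDZ : #D₂ = #Z₁ := by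
    rw [← card_image_of_injective D₂ (hinj.comp Sum.inl_injective),
      ← card_image_of_injective Z₁ (f := fun z => (.inr (v, z) : G.Dart ⊕ V × (B ⊕ C)))
        (fun z z' h => by simpa using h)]
    congr 1
    ext x
    simp only [hD₂, hZ₁, mem_image, mem_filter, mem_univ, true_and, Function.comp]
    constructor
    · rintro ⟨d, ⟨-, z, hz⟩, rfl⟩
      exact ⟨z, ⟨d, by rw [← hz, hpp]⟩, hz.symm⟩
    · rintro ⟨z, ⟨d, hd⟩, rfl⟩
      have h1 : p (.inl d) = .inr (v, z) := by rw [← hd, hpp]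
      have h2 := hadj (.inl d)
      rw [h1, parityGadget_adj_inl_inr] at h2
      exact ⟨d, ⟨h2, z, h1⟩, h1⟩
  have hZ₂C : #Z₂ ≤ b - a := by
    rw [← hC, ← card_univ, ← card_image_of_injective univ (Sum.inr_injective (α := B))]
    refine card_le_card fun z hz => ?_
    obtain ⟨-, z', hz'⟩ := mem_filter.1 hz
    have := hadj (.inr (v, z))
    rw [hz', parityGadget_adj_inr_inr] at this
    obtain ⟨c, rfl⟩ := Sum.isRight_iff.1 this.2.2.1
    simp
  have hZ₂e : Even #Z₂ := by
    have hex : ∀ z, ∃ z', z ∈ Z₂ → p (.inr (v, z)) = .inr (v, z') := by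
      intro z
      by_cases hz : z ∈ Z₂
      · obtain ⟨-, z', hz'⟩ := mem_filter.1 hz
        exact ⟨z', fun _ => hz'⟩
      · exact ⟨z, fun h => absurd h hz⟩
    choose f hf using hex
    have hmem : ∀ z ∈ Z₂, f z ∈ Z₂ := fun z hz => by
      simp only [hZ₂, mem_filter, mem_univ, true_and]
      exact ⟨z, by rw [← hf z hz, hpp]⟩
    refine Z₂.even_card_of_involution f hmem (fun z hz => ?_) (fun z hz => ?_)
    · have := hf _ (hmem z hz)
      rw [← hf z hz, hpp] at this
      simpa using this.symm
    · have := hadj (.inr (v, z))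
      rw [hf z hz, parityGadget_adj_inr_inr] at this
      exact this.2.1.symm
  -- Matching darts to non-darts at `v` gives `r - #D₁ = #D₂ = #Z₁ = r - a - #Z₂`.
  have key : #D₁ = a + #Z₂ := by omega
  have hmod : (a + #Z₂) % 2 = b % 2 := by
    obtain ⟨k, hk⟩ := hZ₂e
    have : a % 2 = b % 2 := hpar
    omega
  have hgoal : a ≤ F.degree v ∧ F.degree v ≤ b ∧ F.degree v ≡ b [MOD 2] := by
    rw [hdeg, key]
    exact ⟨by omega, by omega, hmod⟩
  convert hgoal

end

/-! ### Dart counts and edge cuts -/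

section

variable {V : Type*} [Fintype V] {G : SimpleGraph V} [DecidableRel G.Adj]

theorem card_filter_dart_symm (p : G.Dart → Prop) [DecidablePred p]
    [DecidablePred fun d : G.Dart => p d.symm] :
    #{d : G.Dart | p d.symm} = #{d : G.Dart | p d} :=
  card_nbij' Dart.symm Dart.symm (by simp [Set.MapsTo]) (by simp [Set.MapsTo])
    (by simp [Set.LeftInvOn]) (by simp [Set.LeftInvOn, Set.RightInvOn])

theorem even_card_filter_dart_of_symm {p : G.Dart → Prop} [DecidablePred p]
    (hp : ∀ d, p d → p d.symm) :
    Even #{d : G.Dart | p d} :=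
  even_card_of_involution _ Dart.symm (by simpa using hp) (by simp) fun d _ => d.symm_ne

theorem IsRegularOfDegree.card_filter_dart_fst_mem [DecidableEq V] {r : ℕ} (hreg : G.IsRegularOfDegree r)
    (S : Finset V) : #{d : G.Dart | d.fst ∈ S} = r * #S := by
  have := card_eq_sum_card_fiberwise (f := fun d : G.Dart => d.fst)
    (s := {d : G.Dart | d.fst ∈ S}) (t := S) (by simp [Set.MapsTo])
  rw [this, mul_comm, ← smul_eq_mul, ← sum_const]
  refine sum_congr rfl fun v hv => ?_
  rw [← hreg v, ← G.dart_fst_fiber_card_eq_degree v, filter_filter]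
  congr 1
  ext d
  simp only [mem_filter, mem_univ, true_and, and_iff_right_iff_imp]
  rintro rfl
  exact hv

theorem IsRegularOfDegree.card_filter_dart_snd_mem [DecidableEq V] {r : ℕ} (hreg : G.IsRegularOfDegree r)
    (S : Finset V) : #{d : G.Dart | d.snd ∈ S} = r * #S := by
  rw [← hreg.card_filter_dart_fst_mem S]
  exact card_filter_dart_symm fun d : G.Dart => d.fst ∈ S

/-- An `m`-edge-connected graph has at least `m` edges between any proper nonempty set of vertices
and its complement. -/
theorem IsEdgeConnected.le_card_filter_dart [DecidableEq V] {m : ℕ} (hconn : G.IsEdgeConnected m) {U : Finset V}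
    {u v : V} (hu : u ∈ U) (hv : v ∉ U) : m ≤ #{d : G.Dart | d.fst ∈ U ∧ d.snd ∉ U} := by
  by_contra! hlt
  set D : Finset G.Dart := {d | d.fst ∈ U ∧ d.snd ∉ U} with hD
  have henc : ((D.image Dart.edge : Finset (Sym2 V)) : Set (Sym2 V)).encard < m := by
    rw [Set.encard_coe_eq_coe_finsetCard]
    exact_mod_cast card_image_le.trans_lt hlt
  obtain ⟨w⟩ := hconn u v henc
  obtain ⟨d, -, hdU, hdU'⟩ := w.exists_boundary_dart (U : Set V) (by simpa) (by simpa)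
  have hadj := d.adj
  rw [deleteEdges_adj] at hadj
  refine hadj.2 ?_
  rw [mem_coe, mem_image]
  exact ⟨⟨(d.fst, d.snd), hadj.1⟩, by simpa [hD] using ⟨hdU, hdU'⟩, rfl⟩

/-! ### Shape of a minimal violator, and discharging -/

section Gadget

variable {B C : Type*} [Fintype B] [Fintype C] {X : Finset (G.Dart ⊕ V × (B ⊕ C))}
  {𝒦 : Finset (Finset (G.Dart ⊕ V × (B ⊕ C)))}

-- If `d'` stayed outside `X`, every non-dart neighbour of `d` outside `X` would share its member
-- with `d'`. The only other neighbour is `d.symm`, so `d` would meet at most two members.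
omit [Fintype V] [DecidableRel G.Adj] [Fintype B] [Fintype C] in
theorem IsOddFamily.inl_mem_of_inl_mem (h : (G.parityGadget B C).IsOddFamily X 𝒦)
    (hmin : ∀ x ∈ X, ∀ y₁ y₂, ∃ K ∈ 𝒦, y₁ ∉ K ∧ y₂ ∉ K ∧ ∃ y ∈ K, (G.parityGadget B C).Adj x y)
    {d d' : G.Dart} (hd : .inl d ∈ X) (hdd' : d'.fst = d.fst) : .inl d' ∈ X := by
  by_contra hd'
  obtain ⟨K, hK, h1, h2, y, hy, hadj⟩ := hmin _ hd (.inl d') (.inl d.symm)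
  rcases y with e | ⟨v, z⟩
  · rw [parityGadget_adj_inl_inl] at hadj
    exact h2 (hadj ▸ hy)
  · rw [parityGadget_adj_inl_inr] at hadj
    exact h1 (h.mem_of_adj K hK _ hy _ (by simp [hdd', hadj]) hd')

-- If all darts at `v` were in `X`, the remaining neighbours of `(v, z)` would lie in one clique,
-- hence in one member. So some dart `d` at `v` is outside, hence all are; a surviving `(v, z')`
-- would then put every neighbour of `(v, z)` in the member of `d`.
omit [Fintype V] [DecidableRel G.Adj] [Fintype B] [Fintype C] in
theorem IsOddFamily.mem_and_notMem_of_inr_mem (h : (G.parityGadget B C).IsOddFamily X 𝒦)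
    (hmin : ∀ x ∈ X, ∀ y₁ y₂, ∃ K ∈ 𝒦, y₁ ∉ K ∧ y₂ ∉ K ∧ ∃ y ∈ K, (G.parityGadget B C).Adj x y)
    {v : V} {z : B ⊕ C} (hz : .inr (v, z) ∈ X) :
    (∀ z', .inr (v, z') ∈ X) ∧ ∀ d : G.Dart, d.fst = v → .inl d ∉ X := by
  have hex : ∃ d : G.Dart, d.fst = v ∧ .inl d ∉ X := by
    by_contra! hall
    have key : ∀ y₁, ∃ K ∈ 𝒦, y₁ ∉ K ∧ ∃ z', .inr (v, z') ∈ K ∧ z'.isRight := by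
      intro y₁
      obtain ⟨K, hK, h1, -, y, hy, hadj⟩ := hmin _ hz y₁ y₁
      rcases y with e | ⟨w, z'⟩
      · rw [parityGadget_adj_inr_inl] at hadj
        exact absurd (hall e hadj) (h.notMem K hK _ hy)
      · rw [parityGadget_adj_inr_inr] at hadj
        obtain ⟨rfl, -, -, hr⟩ := hadj
        exact ⟨K, hK, h1, z', hy, hr⟩
    obtain ⟨K, hK, -, z₁, hz₁, hr₁⟩ := key (.inr (v, z))
    obtain ⟨L, hL, hz₁L, z₂, hz₂, hr₂⟩ := key (.inr (v, z₁))
    have hne : z₂ ≠ z₁ := by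
      rintro rfl
      exact hz₁L hz₂
    exact hz₁L (h.mem_of_adj L hL _ hz₂ _ (by simp [hne, hr₁, hr₂]) (h.notMem K hK _ hz₁))
  obtain ⟨d, rfl, hd⟩ := hex
  refine ⟨fun z' => ?_, fun e he heX => hd (h.inl_mem_of_inl_mem hmin heX he.symm)⟩
  by_contra hz'
  obtain ⟨K, hK, h1, -, y, hy, hadj⟩ := hmin _ hz (.inl d) (.inl d)
  have hdz' : (G.parityGadget B C).Adj (.inr (d.fst, z')) (.inl d) := by simp
  rcases y with e | ⟨w, z''⟩
  · rw [parityGadget_adj_inr_inl] at hadj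
    have : .inr (d.fst, z') ∈ K := h.mem_of_adj K hK _ hy _ (by simp [hadj]) hz'
    exact h1 (h.mem_of_adj K hK _ this _ hdz' hd)
  · rw [parityGadget_adj_inr_inr] at hadj
    exact h1 (h.mem_of_adj K hK _ hy _ (by simp [hadj.1]) hd)

/-- The weight of a vertex of the gadget in the discharging argument, where `S` and `T` are the
sets of vertices of `G` whose darts, respectively whose other gadget vertices, are removed. -/
def gadgetCharge [DecidableEq V] (a b r : ℕ) (S T : Finset V) : G.Dart ⊕ V × (B ⊕ C) → ℕ
  | .inl d => (if d.snd ∈ S then b else 0) + (if d.snd ∈ S ∧ d.fst ∈ T then r - a else 0) +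
      if d.snd ∈ T ∧ d.fst ∉ S then r - a else 0
  | .inr p => if p.1 ∈ S ∧ p.2.isLeft then r else 0

/-- Each removed vertex hands out `r`. A dart leaving `S` gives `b` to its reversal and `r - b` to
the copies of `B` at its tail. A vertex over `T` gives 1 to each dart there; such a dart passes its
`r - a` to its reversal unless it points into `S`. -/
theorem sum_gadgetCharge [DecidableEq V] {a b r : ℕ} (hreg : G.IsRegularOfDegree r) (hbr : b ≤ r)
    (hB : Fintype.card B = r - b) (S T : Finset V) :
    ∑ x : G.Dart ⊕ V × (B ⊕ C), gadgetCharge a b r S T x = r * (r * #S + (r - a) * #T) := by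
  have h1 : #{d : G.Dart | d.snd ∈ S ∧ d.fst ∈ T} + #{d : G.Dart | d.snd ∈ T ∧ d.fst ∉ S} =
      r * #T := by
    rw [← hreg.card_filter_dart_snd_mem T,
      ← card_filter_dart_symm fun d : G.Dart => d.snd ∈ S ∧ d.fst ∈ T,
      ← card_filter_add_card_filter_not (s := {d : G.Dart | d.snd ∈ T}) (fun d => d.fst ∈ S),
      filter_filter, filter_filter]
    simp [and_comm]
  have h2 : ∑ p : V × (B ⊕ C), (if p.1 ∈ S ∧ p.2.isLeft then r else 0) = #S * (r - b) * r := by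
    rw [← sum_filter, sum_const, smul_eq_mul]
    congr 1
    have : ({p | p.1 ∈ S ∧ p.2.isLeft} : Finset (V × (B ⊕ C))) =
        S ×ˢ (univ : Finset B).map .inl := by
      ext ⟨v, z | z⟩ <;> simp
    rw [this, card_product, card_map, card_univ, hB]
  rw [Fintype.sum_sum_type]
  simp only [gadgetCharge]
  rw [h2, sum_add_distrib, sum_add_distrib, ← sum_filter, ← sum_filter, ← sum_filter]
  simp only [sum_const, smul_eq_mul]
  rw [hreg.card_filter_dart_snd_mem, add_assoc, add_assoc, ← add_assoc (_ * (r - a)), ← add_mul, h1]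
  obtain ⟨k, rfl⟩ := Nat.exists_eq_add_of_le hbr
  rw [Nat.add_sub_cancel_left]
  ring

/-- Each member of the odd family has charge at least `r`. -/
theorem IsOddFamily.le_sum_gadgetCharge [DecidableEq V] {a b r m : ℕ} (h : (G.parityGadget B C).IsOddFamily X 𝒦)
    (hreg : G.IsRegularOfDegree r) (hconn : G.IsEdgeConnected m) (hab : a ≤ b) (har : a < r)
    (hbr : b ≤ r) (hB : Fintype.card B = r - b) (hC : Fintype.card C = b - a)
    (hCe : Even (Fintype.card C)) (haV : Even (a * Fintype.card V))
    (hcut : ∀ n s t, Odd (a * n + t) → (Even (s + t) ↔ Even (r * n)) → m ≤ s + t →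
      r ≤ b * s + (r - a) * t)
    {S T : Finset V} (hST : Disjoint S T) (hXS : ∀ d : G.Dart, .inl d ∈ X ↔ d.fst ∈ S)
    (hXT : ∀ v z, .inr (v, z) ∈ X ↔ v ∈ T) {K : Finset (G.Dart ⊕ V × (B ⊕ C))} (hK : K ∈ 𝒦) :
    r ≤ ∑ x ∈ K, gadgetCharge a b r S T x := by
  classical
  have hcard : Fintype.card (B ⊕ C) = r - a := by
    rw [Fintype.card_sum, hB, hC]; omega
  have hne : Nonempty (B ⊕ C) := Fintype.card_pos_iff.1 (by omega)
  have hclosed := h.mem_of_adj K hK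
  by_cases hcase1 : ∃ v z, v ∈ S ∧ z.isLeft ∧ .inr (v, z) ∈ K
  · obtain ⟨v, z, hv, hz, hvz⟩ := hcase1
    refine le_trans ?_ (single_le_sum (fun _ _ => Nat.zero_le _) hvz)
    simp [gadgetCharge, hv, hz]
  -- Such a dart has both its reversal and its non-dart neighbours in `X`; its own charge is `b + (r
  -- - a) ≥ r`.
  by_cases hcase2 : ∃ d : G.Dart, d.snd ∈ S ∧ d.fst ∈ T ∧ .inl d ∈ K
  · obtain ⟨d, hdS, hdT, hd⟩ := hcase2
    refine le_trans ?_ (single_le_sum (fun _ _ => Nat.zero_le _) hd)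
    simp only [gadgetCharge, hdS, hdT, and_self, if_true]
    omega
  push Not at hcase1 hcase2
  set U : Finset V := {v | v ∉ S ∧ v ∉ T ∧ ∃ z, .inr (v, z) ∈ K} with hU
  have hUST : ∀ v ∈ U, v ∉ S ∧ v ∉ T := fun v hv => by
    simp only [hU, mem_filter] at hv
    exact ⟨hv.2.1, hv.2.2.1⟩
  have hKd : ∀ d : G.Dart, d.fst ∉ S → d.fst ∉ T → (.inl d ∈ K ↔ d.fst ∈ U) := by
    intro d hS hT
    simp only [hU, mem_filter, mem_univ, hS, hT, not_false_eq_true, true_and]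
    constructor
    · intro hd
      exact ⟨hne.some, hclosed _ hd _ (by simp) (by simpa [hXT])⟩
    · rintro ⟨z, hz⟩
      exact hclosed _ hz _ (by simp) (by simpa [hXS])
  have hKd' : ∀ d : G.Dart, d.fst ∈ U → .inl d ∈ K := fun d hd =>
    (hKd d (hUST _ hd).1 (hUST _ hd).2).2 hd
  have hdart : ∀ v ∉ S, v ∉ T → ∃ d : G.Dart, d.fst = v := by
    intro v _ _
    have : 0 < G.degree v := by rw [hreg v]; omega
    obtain ⟨w, hw⟩ := (G.degree_pos_iff_exists_adj v).1 this
    exact ⟨⟨(v, w), hw⟩, rfl⟩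
  have hKz : ∀ v z, v ∉ S → v ∉ T → (.inr (v, z) ∈ K ↔ v ∈ U) := by
    intro v z hS hT
    obtain ⟨d, rfl⟩ := hdart v hS hT
    rw [← hKd d hS hT]
    exact ⟨fun hz => hclosed _ hz _ (by simp) (by simpa [hXS]),
      fun hd => hclosed _ hd _ (by simp) (by simpa [hXT])⟩
  have hrev : ∀ d : G.Dart, .inl d ∈ K → d.snd ∉ S → .inl d.symm ∈ K := fun d hd hS =>
    hclosed _ hd _ (by simp) (by simpa [hXS])
  have hKS : ∀ d : G.Dart, .inl d ∈ K → d.fst ∉ S := fun d hd hS =>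
    h.notMem K hK _ hd ((hXS d).2 hS)
  have hsnd : ∀ d : G.Dart, .inl d ∈ K → d.snd ∉ S → d.snd ∉ T → d.snd ∈ U := fun d hd hS hT =>
    (hKd d.symm hS hT).1 (hrev d hd hS)
  set s := #{d : G.Dart | d.fst ∈ U ∧ d.snd ∈ S} with hs
  set t := #{d : G.Dart | d.fst ∈ U ∧ d.snd ∈ T} with ht
  have hcharge : b * s + (r - a) * t ≤ ∑ x ∈ K, gadgetCharge a b r S T x := by
    have hsub : ({d : G.Dart | d.fst ∈ U} : Finset G.Dart).image .inl ⊆ K := by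
      intro x hx
      simp only [mem_image, mem_filter, mem_univ, true_and] at hx
      obtain ⟨d, hd, rfl⟩ := hx
      exact hKd' d hd
    refine le_trans (le_of_eq ?_) (sum_le_sum_of_subset hsub)
    rw [sum_image Sum.inl_injective.injOn]
    have : ∀ d ∈ ({d : G.Dart | d.fst ∈ U} : Finset G.Dart),
        gadgetCharge (B := B) (C := C) a b r S T (.inl d) =
          (if d.snd ∈ S then b else 0) + if d.snd ∈ T then r - a else 0 := by
      intro d hd
      simp only [mem_filter, mem_univ, true_and] at hd
      simp [gadgetCharge, hUST _ hd]
    rw [sum_congr rfl this, sum_add_distrib, ← sum_filter, ← sum_filter, sum_const, sum_const,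
      filter_filter, filter_filter, smul_eq_mul, smul_eq_mul, mul_comm b, mul_comm (r - a)]
  have hst : #{d : G.Dart | d.fst ∈ U ∧ d.snd ∉ U} = s + t := by
    rw [hs, ht, ← card_union_of_disjoint]
    · congr 1
      ext d
      simp only [mem_filter, mem_univ, true_and, mem_union, ← and_or_left, and_congr_right_iff]
      intro hd
      constructor
      · intro hdU
        by_contra! hcon
        exact hdU (hsnd d (hKd' d hd) hcon.1 hcon.2)
      · rintro (hd' | hd') hdU
        exacts [(hUST _ hdU).1 hd', (hUST _ hdU).2 hd']
    · refine Finset.disjoint_left.2 fun d hd hd' => ?_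
      exact Finset.disjoint_left.1 hST (mem_filter.1 hd).2.2 (mem_filter.1 hd').2.2
  have hrn : r * #U = #{d : G.Dart | d.fst ∈ U ∧ d.snd ∈ U} + (s + t) := by
    rw [← hst, ← hreg.card_filter_dart_fst_mem U,
      ← card_filter_add_card_filter_not (s := {d : G.Dart | d.fst ∈ U}) (fun d => d.snd ∈ U),
      filter_filter, filter_filter]
  have hUU : Even #{d : G.Dart | d.fst ∈ U ∧ d.snd ∈ U} :=
    even_card_filter_dart_of_symm (p := fun d : G.Dart => d.fst ∈ U ∧ d.snd ∈ U) fun d hd => ⟨hd.2, hd.1⟩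
  -- Darts inside `T` occur in `K` together with their reversals, so they do not affect parity.
  set TT := #{d : G.Dart | .inl d ∈ K ∧ d.fst ∈ T ∧ d.snd ∈ T} with hTT
  have hTTe : Even TT :=
    even_card_filter_dart_of_symm
      (p := fun d : G.Dart => .inl d ∈ K ∧ d.fst ∈ T ∧ d.snd ∈ T) fun d hd =>
      ⟨hrev d hd.1 (Finset.disjoint_right.1 hST hd.2.2), hd.2.2, hd.2.1⟩
  have hKdcard : #{d : G.Dart | .inl d ∈ K} = r * #U + (t + TT) := by
    rw [← hreg.card_filter_dart_fst_mem U, ht,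
      ← card_filter_dart_symm fun d : G.Dart => d.fst ∈ U ∧ d.snd ∈ T, hTT,
      ← card_union_of_disjoint, ← card_union_of_disjoint]
    · congr 1
      ext d
      simp only [mem_filter, mem_univ, true_and, mem_union]
      constructor
      · intro hd
        by_cases hT : d.fst ∈ T
        · by_cases hT' : d.snd ∈ T
          · exact .inr (.inr ⟨hd, hT, hT'⟩)
          · exact .inr (.inl ⟨hsnd d hd (fun hS => hcase2 d hS hT hd) hT', hT⟩)
        · exact .inl ((hKd d (hKS d hd) hT).1 hd)
      · rintro (hd | ⟨hd, hT⟩ | ⟨hd, -⟩)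
        · exact hKd' d hd
        · refine hclosed _ (hKd' d.symm hd) _ (by simp) ?_
          rw [hXS]
          exact Finset.disjoint_right.1 hST hT
        · exact hd
    · refine Finset.disjoint_left.2 fun d hd hd' => ?_
      have h1 := hUST _ (mem_filter.1 hd).2
      rcases mem_union.1 hd' with hd' | hd'
      exacts [h1.2 (mem_filter.1 hd').2.2, h1.2 (mem_filter.1 hd').2.2.1]
    · refine Finset.disjoint_left.2 fun d hd hd' => ?_
      exact (hUST _ (mem_filter.1 hd).2.1).2 (mem_filter.1 hd').2.2.2
  -- Over `S` only whole cliques on `C` remain, each of even size.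
  set S' : Finset V := {v ∈ S | ∃ c, .inr (v, .inr c) ∈ K} with hS'
  have hKzset : ({p | .inr p ∈ K} : Finset (V × (B ⊕ C))) =
      U ×ˢ univ ∪ S' ×ˢ (univ : Finset C).map .inr := by
    ext ⟨v, z⟩
    simp only [mem_filter, mem_univ, true_and, mem_union, mem_product, and_true, mem_map, hS']
    have h1 := hcase1 v z
    have h2 := hKz v z
    have h3 := hUST v
    have h4 : .inr (v, z) ∈ K → v ∉ T := fun hz hT => h.notMem K hK _ hz ((hXT v z).2 hT)
    rcases z with i | c
    · have h6 : v ∈ S → .inr (v, .inl i) ∉ K := fun hS => h1 hS rfl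
      simp only [reduceCtorEq, Function.Embedding.inr_apply, and_false, exists_false, or_false]
      exact ⟨fun hi => (h2 (fun hS => h6 hS hi) (h4 hi)).1 hi,
        fun hU' => (h2 (h3 hU').1 (h3 hU').2).2 hU'⟩
    · have h5 : v ∈ S → ∀ c', .inr (v, .inr c') ∈ K → .inr (v, .inr c) ∈ K := by
        intro hS c' hc'
        by_cases hcc : c = c'
        · rwa [hcc]
        · refine hclosed _ hc' _ (by simp [Ne.symm hcc]) ?_
          rw [hXT]
          exact Finset.disjoint_left.1 hST hS
      simp
      constructor
      · intro hc
        by_cases hS : v ∈ S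
        · exact .inr ⟨hS, c, hc⟩
        · exact .inl ((h2 hS (h4 hc)).1 hc)
      · rintro (hU' | ⟨hS, c', hc'⟩)
        · exact (h2 (h3 hU').1 (h3 hU').2).2 hU'
        · exact h5 hS c' hc'
  have hKzcard : #{p : V × (B ⊕ C) | .inr p ∈ K} = (r - a) * #U + #S' * Fintype.card C := by
    rw [hKzset, card_union_of_disjoint, card_product, card_product, card_map, card_univ, card_univ,
      hcard, mul_comm]
    refine Finset.disjoint_left.2 fun p hp hp' => ?_
    rw [mem_product] at hp hp'
    exact (hUST _ hp.1).1 (mem_filter.1 hp'.1).1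
  have hKcard : #K = #{d : G.Dart | .inl d ∈ K} + #{p : V × (B ⊕ C) | .inr p ∈ K} := by
    rw [← card_disjSum]
    congr 1
    ext (d | p) <;> simp
  have hodd : Odd (a * #U + t) := by
    have := h.odd_card K hK
    rw [hKcard, hKdcard, hKzcard] at this
    have h2 : a * #U + (r - a) * #U = r * #U := by
      rw [← add_mul, Nat.add_sub_cancel' har.le]
    have h3 : Even (#S' * Fintype.card C) := hCe.mul_left _
    grind
  refine le_trans (hcut #U s t hodd ?_ ?_) hcharge
  · grind
  · have hUne : U.Nonempty := by
      rw [nonempty_iff_ne_empty]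
      intro hU0
      simp [ht, hU0] at hodd
    obtain ⟨u, hu⟩ := hUne
    -- If `U` is everything there is no cut, but then `t = 0` and `a * #U` is even by `haV`.
    by_cases hall : ∀ v, v ∈ U
    · exfalso
      have : t = 0 := by
        rw [ht, card_eq_zero, filter_eq_empty_iff]
        exact fun d _ hd => (hUST _ (hall _)).2 hd.2
      rw [this, eq_univ_of_forall hall, card_univ, add_zero] at hodd
      exact Nat.not_even_iff_odd.2 hodd haV
    · push Not at hall
      obtain ⟨v, hv⟩ := hall
      rw [← hst]
      exact hconn.le_card_filter_dart hu hv

end Gadget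

end

/-! ### The cut criterion -/

section

variable {V : Type*} [Fintype V] {G : SimpleGraph V} [DecidableRel G.Adj]

/-- A regular graph has an `(a, b)`-parity factor as soon as every edge cut of size at least `m`,
split into `s` and `t` edges subject to the parity constraints, satisfies
`r ≤ b * s + (r - a) * t`. -/
theorem IsRegularOfDegree.hasParityFactor {a b r m : ℕ} (hreg : G.IsRegularOfDegree r)
    (hconn : G.IsEdgeConnected m) (hab : a ≤ b) (har : a < r) (hbr : b ≤ r)
    (hpar : a ≡ b [MOD 2]) (haV : Even (a * Fintype.card V))
    (hcut : ∀ n s t, Odd (a * n + t) → (Even (s + t) ↔ Even (r * n)) → m ≤ s + t →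
      r ≤ b * s + (r - a) * t) : G.HasParityFactor a b := by
  classical
  by_contra hno
  have hmod : a % 2 = b % 2 := hpar
  have hCe : Even (Fintype.card (Fin (b - a))) := by
    rw [Fintype.card_fin, Nat.even_iff]; omega
  have hdarts : Fintype.card G.Dart = r * Fintype.card V := by
    rw [dart_card_eq_sum_degrees, sum_congr rfl fun v _ => hreg v]
    simp [mul_comm]
  have hcardW : Even (Fintype.card (G.Dart ⊕ V × (Fin (r - b) ⊕ Fin (b - a)))) := by
    rw [Fintype.card_sum, Fintype.card_prod, Fintype.card_sum, Fintype.card_fin, Fintype.card_fin,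
      hdarts, show r - b + (b - a) = r - a by omega]
    have h1 : a * Fintype.card V + (r - a) * Fintype.card V = r * Fintype.card V := by
      rw [← add_mul, Nat.add_sub_cancel' har.le]
    grind
  obtain ⟨X, 𝒦, hX, hlt, hmin⟩ := exists_isOddFamily_minimal
    (H := G.parityGadget (Fin (r - b)) (Fin (b - a))) hcardW fun M hM =>
      hno (hasParityFactor_of_isPerfectMatching hreg hab hbr hpar (by simp) (by simp) hM)
  have hcard : Fintype.card (Fin (r - b) ⊕ Fin (b - a)) = r - a := by
    rw [Fintype.card_sum, Fintype.card_fin, Fintype.card_fin]; omega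
  have hne : Nonempty (Fin (r - b) ⊕ Fin (b - a)) := Fintype.card_pos_iff.1 (by omega)
  set S : Finset V := {v | ∃ d : G.Dart, d.fst = v ∧ .inl d ∈ X} with hS
  set T : Finset V := {v | ∃ z, .inr (v, z) ∈ X} with hT
  have hXS : ∀ d : G.Dart, .inl d ∈ X ↔ d.fst ∈ S := by
    intro d
    simp only [hS, mem_filter, mem_univ, true_and]
    exact ⟨fun hd => ⟨d, rfl, hd⟩, fun ⟨e, he, hd⟩ => hX.inl_mem_of_inl_mem hmin hd he.symm⟩
  have hXT : ∀ v z, .inr (v, z) ∈ X ↔ v ∈ T := by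
    intro v z
    simp only [hT, mem_filter, mem_univ, true_and]
    exact ⟨fun hz => ⟨z, hz⟩, fun ⟨z', hz'⟩ => (hX.mem_and_notMem_of_inr_mem hmin hz').1 z⟩
  have hST : Disjoint S T := by
    refine Finset.disjoint_left.2 fun v hvS hvT => ?_
    obtain ⟨d, rfl, hd⟩ := (mem_filter.1 hvS).2
    obtain ⟨z, hz⟩ := (mem_filter.1 hvT).2
    exact (hX.mem_and_notMem_of_inr_mem hmin hz).2 d rfl hd
  have hXcard : #X = r * #S + (r - a) * #T := by
    have : X = ({d : G.Dart | d.fst ∈ S} : Finset G.Dart).disjSum (T ×ˢ univ) := by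
      ext (d | ⟨v, z⟩)
      · simp [hXS]
      · simp [hXT]
    rw [this, card_disjSum, hreg.card_filter_dart_fst_mem, card_product, card_univ, hcard,
      mul_comm #T]
  have h1 : #𝒦 * r ≤ ∑ K ∈ 𝒦, ∑ x ∈ K, gadgetCharge a b r S T x := by
    rw [← smul_eq_mul]
    exact card_nsmul_le_sum _ _ _ fun K hK => hX.le_sum_gadgetCharge hreg hconn hab har hbr
      (by simp) (by simp) hCe haV hcut hST hXS hXT hK
  have h2 : ∑ K ∈ 𝒦, ∑ x ∈ K, gadgetCharge a b r S T x ≤ r * #X := by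
    rw [hXcard, ← sum_gadgetCharge (B := Fin (r - b)) (C := Fin (b - a)) hreg hbr (by simp) S T]
    refine le_trans (le_of_eq (sum_biUnion hX.pairwiseDisjoint).symm) ?_
    exact sum_le_sum_of_subset (subset_univ _)
  have h3 : r * #𝒦 ≤ r * #X := by linarith [mul_comm r #𝒦]
  exact absurd (Nat.le_of_mul_le_mul_left h3 (by omega)) (by omega)

end

end SimpleGraph

/-! ### The numerical conditions -/

theorem Nat.le_mul_of_div_le_cast {r m b : ℕ} (hm : 0 < m) (h : (r : ℝ) / m ≤ b) : r ≤ b * m := by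
  rw [div_le_iff₀ (by exact_mod_cast hm)] at h
  exact_mod_cast h

theorem Nat.le_sub_mul_of_cast_le {r m a : ℕ} (hm : 0 < m) (har : a ≤ r)
    (h : (a : ℝ) ≤ r * (1 - 1 / m)) : r ≤ (r - a) * m := by
  have hm' : (0 : ℝ) < m := by exact_mod_cast hm
  have h1 := mul_le_mul_of_nonneg_right h hm'.le
  have h2 : (r : ℝ) * (1 - 1 / m) * m = r * m - r := by field_simp
  rw [h2] at h1
  have h3 : (r : ℝ) ≤ ((r - a : ℕ) : ℝ) * m := by
    rw [Nat.cast_sub har]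
    linarith
  exact_mod_cast h3

theorem theorem2p1 {V : Type*} [Fintype V] (G : SimpleGraph V) [DecidableRel G.Adj]
    (a b r m mstar : ℕ)
    (ha : 1 ≤ a) (hab : a ≤ b) (hbr : b < r) (hpar : a ≡ b [MOD 2])
    (hm : 1 ≤ m) (hmstar : mstar = m ∨ mstar = m + 1) (hmstar_odd : Odd mstar)
    (hconn : G.IsEdgeConnected m) (hreg : G.IsRegularOfDegree r)
    (hcases :
      (Even r ∧ Odd a ∧ Odd b ∧ Even (Fintype.card V) ∧
        (r : ℝ) / m ≤ b ∧ (a : ℝ) ≤ r * (1 - 1 / m)) ∨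
      (Odd r ∧ Even a ∧ Even b ∧ (a : ℝ) ≤ r * (1 - 1 / mstar)) ∨
      (Odd r ∧ Odd a ∧ Odd b ∧ (r : ℝ) / mstar ≤ b)) :
    G.HasParityFactor a b := by
  have har : a < r := by omega
  have hodd_le : ∀ k, Odd k → m ≤ k → mstar ≤ k := by
    intro k hk hmk
    obtain ⟨i, hi⟩ := hk
    obtain ⟨j, hj⟩ := hmstar_odd
    omega
  -- A cut with edges of both kinds needs no connectivity: one edge of each kind already gives `r`.
  have hbc : r ≤ b + (r - a) := by omega
  rcases hcases with ⟨-, -, -, hV, hb, ha'⟩ | ⟨hr, ha2, -, ha'⟩ | ⟨hr, ha2, -, hb⟩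
  · have hb' := Nat.le_mul_of_div_le_cast hm hb
    have hc' := Nat.le_sub_mul_of_cast_le hm har.le ha'
    refine hreg.hasParityFactor hconn hab har hbr.le hpar (hV.mul_left _) fun n s t _ _ hst => ?_
    rcases le_total b (r - a) with hle | hle
    · calc r ≤ b * (s + t) := hb'.trans (Nat.mul_le_mul_left _ hst)
        _ = b * s + b * t := mul_add _ _ _
        _ ≤ _ := by gcongr
    · calc r ≤ (r - a) * (s + t) := hc'.trans (Nat.mul_le_mul_left _ hst)
        _ = (r - a) * s + (r - a) * t := mul_add _ _ _
        _ ≤ _ := by gcongr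
  · have hc' := Nat.le_sub_mul_of_cast_le (by omega) har.le ha'
    refine hreg.hasParityFactor hconn hab har hbr.le hpar (ha2.mul_right _)
      fun n s t hodd _ hst => ?_
    -- As `a` is even, `t` is odd; when `s = 0` the cut has odd size, which lifts `m` to `mstar`.
    have ht : Odd t := by grind
    rcases Nat.eq_zero_or_pos s with rfl | hs
    · have := Nat.mul_le_mul_left (r - a) (hodd_le t ht (by omega))
      omega
    · have h1 := Nat.mul_le_mul_left b hs
      have h2 := Nat.mul_le_mul_left (r - a) ht.pos
      omega
  · have hb' := Nat.le_mul_of_div_le_cast (by omega) hb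
    have hV : Even (Fintype.card V) := by
      have h1 := G.sum_degrees_eq_twice_card_edges
      rw [Finset.sum_congr rfl fun v _ => hreg v, Finset.sum_const, Finset.card_univ,
        smul_eq_mul] at h1
      have h2 : Even (Fintype.card V * r) := by rw [h1]; exact even_two_mul _
      exact (Nat.even_mul.1 h2).resolve_right (Nat.not_even_iff_odd.2 hr)
    refine hreg.hasParityFactor hconn hab har hbr.le hpar (hV.mul_left _)
      fun n s t hodd hst2 hst => ?_
    -- As `r` and `a` are odd, `n + t` is odd while `s + t` has the parity of `n`.
    have hs : Odd s := by grind
    rcases Nat.eq_zero_or_pos t with rfl | ht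
    · have := Nat.mul_le_mul_left b (hodd_le s hs (by omega))
      omega
    · have h1 := Nat.mul_le_mul_left b hs.pos
      have h2 := Nat.mul_le_mul_left (r - a) ht
      omega
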